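/- Graphs may have loops and multiple edges; every undirected edge consists of two directed edges (darts) $e,\bar e$, and $\mathbb{E}(X)$ denotes the set of darts of $X$, with origin $o(e)$ and terminus $t(e)$. Put $\mathrm{Jac}(X)=\mathrm{Div}^0(X)/\mathrm{Pr}(X)$, where $\mathrm{Pr}(X)$ is generated by the divisors $\sum_{o(e)=v}(v-t(e))$, $v\in V(X)$. Let $p$ be a prime, $\mathcal{G}$ a uniform pro-$p$ ($p$-adic Lie) group of dimension $d$, and $\mathcal{G}_n=\mathcal{G}/\mathcal{G}^{p^n}$. Let $X$ be a finite connected graph, $\alpha:\mathbb{E}(X)\to\mathcal{G}$ a voltage assignment ($\alpha(\bar e)=\alpha(e)^{-1}$), and $I_v\le\mathcal{G}$ a closed subgroup for every $v\in V(X)$. For $n\ge 0$ let $X_n$ be the $n$-th layer of the associated branched $\mathcal{G}$-tower: with $\alpha_n$ and $I_{v,n}$ the images of $\alpha$ and $I_v$ in $\mathcal{G}_n$, its vertices are $\bigsqcup_v\{v\}\times\mathcal{G}_n/I_{v,n}$, its darts are $\mathbb{E}(X)\times\mathcal{G}_n$, the dart $(e,g)$ goes from $(o(e),gI_{o(e),n})$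 to $(t(e),g\alpha_n(e)I_{t(e),n})$, its inverse is $(\bar e,g\alpha_n(e))$, and $\mathcal{G}_n$ acts by left multiplication. Assume that all $X_n$ are connected and planar, and fix for every $n$ an embedding of $X_n$ in the oriented sphere. Let $X_n^\vee$ be the dual graph: its vertices are the faces of $X_n$, and every dart $e$ of $X_n$ has a dual dart $e^\vee$, which crosses $e$ from left to right, so that $o(e^\vee)$ and $t(e^\vee)$ are the faces to the left and to the right of $e$, and $\overline{e^\vee}=\bar e^{\vee}$. Assume that $(X_n^\vee)_n$ is a $\mathcal{G}$-tower as well, with Galois action compatible with taking duals; that is, there are a voltage assignment on $X_0^\vee$ with values in $\mathcal{G}$ and closed subgroups of $\mathcal{G}$ indexed by $V(X_0^\vee)$ such that, for every $n$, $X_n^\vee$ is identified with the $n$-th layer of the associated tower by a graph isomorphism for which the action of $\mathcal{G}_n$ satisfies $g\cdot e^\vee=(g\cdot e)^\vee$ for all $g\in\mathcal{G}_n$ and $e\in\mathbb{E}(X_n)$. A dart assignment on $X_n$ is a function $\phi:\mathbb{E}(X_n)\to\mathbb{Z}$ with $\phi(e)+\phi(\bar e)=0$. Put $$\partial\phi=\sum_{v\in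 V(X_n)}\ \sum_{o(e)=v}\phi(e)\,v\in\mathrm{Div}^0(X_n),\qquad \partial^*\phi=\sum_{f}\ \sum_{e\in f^\circ}\phi(e)\,f\in\mathrm{Div}^0(X_n^\vee),$$ where $f$ runs over the faces of $X_n$ and $f^\circ$ is the counterclockwise boundary of $f$, i.e. the set of darts that have $f$ on their left. **Theorem 5.6.** For every $n$, each $u\in\mathrm{Div}^0(X_n)$ is of the form $u=\partial\phi$ for some dart assignment $\phi$, and there is an isomorphism of groups $$\theta:\mathrm{Jac}(X_n)\longrightarrow\mathrm{Jac}(X_n^\vee),\qquad \theta([\partial\phi])=[\partial^*\phi]\ \text{ for all dart assignments }\phi,$$ which is $\mathcal{G}_n$-equivariant: $\theta(g\cdot y)=g\cdot\theta(y)$ for all $g\in\mathcal{G}_n$ and $y\in\mathrm{Jac}(X_n)$. In particular $\mathrm{Jac}(X_n)\cong\mathrm{Jac}(X_n^\vee)$ as Galois modules. -/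

import Mathlib

universe u v w x

/-- Graphs with directed edges (darts): incidence `e ↦ (o e, t e)` and a fixed-point-free inversion.
Loops and multiple edges are allowed; an undirected edge is a pair `{e, inv e}`. -/
structure SerreGraph where
  V : Type u
  E : Type v
  o : E → V
  t : E → V
  inv : E → E
  inv_ne : ∀ e, inv e ≠ e
  inv_inv : ∀ e, inv (inv e) = e
  o_inv : ∀ e, o (inv e) = t e
  t_inv : ∀ e, t (inv e) = o e

namespace SerreGraph

/-- Any two vertices are joined by a path, and there is at least one vertex. -/
def Connected (X : SerreGraph.{u, v}) : Prop :=
  Nonempty X.V ∧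
    ∀ a b : X.V, Relation.ReflTransGen (fun a b => ∃ e, X.o e = a ∧ X.t e = b) a b

/-! ### Divisors and the Jacobian -/

/-- `Div(X)`, the free abelian group on the vertices. -/
abbrev Div (X : SerreGraph.{u, v}) : Type u := X.V →₀ ℤ

/-- `deg (∑ a_v v) = ∑ a_v`. -/
noncomputable def deg (X : SerreGraph.{u, v}) : X.Div →+ ℤ :=
  Finsupp.liftAddHom fun _ => AddMonoidHom.id ℤ

/-- Divisors of degree zero. -/
noncomputable def Div0 (X : SerreGraph.{u, v}) : AddSubgroup X.Div := X.deg.ker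

/-- The divisor `div(ψ_v)` of the indicator function of `v`. Its coefficient at `v` is the number of
darts leaving `v` that are not loops, that is `#E^o_v` minus twice the number of undirected loops at
`v`; its coefficient at `w ≠ v` is minus the number of undirected edges between `v` and `w`. -/
noncomputable def divIndicator (X : SerreGraph.{u, v}) (a : X.V) : X.Div :=
  ∑ᶠ e : {e : X.E // X.o e = a}, (Finsupp.single a 1 - Finsupp.single (X.t e.1) 1)

/-- Principal divisors of a finite graph: the image of `div`, which is generated by the divisors of
the indicator functions. -/
noncomputable def Pr (X : SerreGraph.{u, v}) : AddSubgroup X.Div :=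
  AddSubgroup.closure (Set.range X.divIndicator)

/-- `Jac(X) = Div⁰(X) / Pr(X)`. -/
abbrev Jac (X : SerreGraph.{u, v}) : Type u := X.Div0 ⧸ X.Pr.addSubgroupOf X.Div0

/-- The class of a degree zero divisor. -/
noncomputable def Jac.mk (X : SerreGraph.{u, v}) : X.Div0 →+ X.Jac :=
  QuotientAddGroup.mk' (X.Pr.addSubgroupOf X.Div0)

/-! ### Isomorphisms, automorphisms, and their action on the Jacobian -/

/-- Isomorphisms of graphs (compatibility with termini follows from the two axioms). -/
@[ext] structure Iso (X : SerreGraph.{u, v}) (Y : SerreGraph.{w, x}) where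
  onV : X.V ≃ Y.V
  onE : X.E ≃ Y.E
  map_o : ∀ e, onV (X.o e) = Y.o (onE e)
  map_inv : ∀ e, onE (X.inv e) = Y.inv (onE e)

theorem Iso.map_t {X : SerreGraph.{u, v}} {Y : SerreGraph.{w, x}} (f : Iso X Y) (e : X.E) :
    f.onV (X.t e) = Y.t (f.onE e) := by
  rw [← X.o_inv, f.map_o, f.map_inv, Y.o_inv]

/-- `Aut(X)`, a group under composition. -/
abbrev Aut (X : SerreGraph.{u, v}) := Iso X X

instance (X : SerreGraph.{u, v}) : Group X.Aut where
  mul f g := ⟨g.onV.trans f.onV, g.onE.trans f.onE,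
    fun e => by simp [f.map_o, g.map_o], fun e => by simp [f.map_inv, g.map_inv]⟩
  one := ⟨Equiv.refl _, Equiv.refl _, fun _ => rfl, fun _ => rfl⟩
  inv f := ⟨f.onV.symm, f.onE.symm,
    fun e => by rw [Equiv.symm_apply_eq, f.map_o, Equiv.apply_symm_apply],
    fun e => by rw [Equiv.symm_apply_eq, f.map_inv, Equiv.apply_symm_apply]⟩
  mul_assoc _ _ _ := rfl
  one_mul _ := rfl
  mul_one _ := rfl
  inv_mul_cancel f := Iso.ext (Equiv.self_trans_symm f.onV) (Equiv.self_trans_symm f.onE)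

/-- Transport of automorphisms along an isomorphism: `a ↦ f⁻¹ ∘ a ∘ f`. -/
def Iso.conj {X : SerreGraph.{u, v}} {Y : SerreGraph.{w, x}} (f : Iso X Y) : Y.Aut →* X.Aut where
  toFun a := ⟨(f.onV.trans a.onV).trans f.onV.symm, (f.onE.trans a.onE).trans f.onE.symm,
    fun e => by simp [Equiv.symm_apply_eq, f.map_o, a.map_o],
    fun e => by simp [Equiv.symm_apply_eq, f.map_inv, a.map_inv]⟩
  map_one' := Iso.ext (Equiv.self_trans_symm f.onV) (Equiv.self_trans_symm f.onE)
  map_mul' a b := by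
    refine Iso.ext (Equiv.ext fun y => ?_) (Equiv.ext fun y => ?_)
    · change f.onV.symm (a.onV (b.onV (f.onV y))) =
        f.onV.symm (a.onV (f.onV (f.onV.symm (b.onV (f.onV y)))))
      rw [Equiv.apply_symm_apply]
    · change f.onE.symm (a.onE (b.onE (f.onE y))) =
        f.onE.symm (a.onE (f.onE (f.onE.symm (b.onE (f.onE y)))))
      rw [Equiv.apply_symm_apply]

/-- The action of an automorphism on divisors, `∑ a_v v ↦ ∑ a_v f(v)`. -/
noncomputable def Aut.onDiv {X : SerreGraph.{u, v}} (f : X.Aut) : X.Div →+ X.Div :=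
  (Finsupp.domCongr f.onV).toAddMonoidHom

theorem Aut.onDiv_single {X : SerreGraph.{u, v}} (f : X.Aut) (a : X.V) (n : ℤ) :
    f.onDiv (Finsupp.single a n) = Finsupp.single (f.onV a) n := by
  simp [Aut.onDiv]

theorem Aut.onDiv_mem_Div0 {X : SerreGraph.{u, v}} (f : X.Aut) {D : X.Div} (hD : D ∈ X.Div0) :
    f.onDiv D ∈ X.Div0 := by
  have h : X.deg.comp f.onDiv = X.deg := by
    ext a
    simp [Aut.onDiv_single, deg]
  have h' := DFunLike.congr_fun h D
  rw [Div0, AddMonoidHom.mem_ker] at hD ⊢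
  rw [← hD, ← h']
  rfl

theorem Aut.onDiv_divIndicator {X : SerreGraph.{u, v}} (f : X.Aut) (a : X.V) :
    f.onDiv (X.divIndicator a) = X.divIndicator (f.onV a) := by
  let s : {e : X.E // X.o e = a} ≃ {e : X.E // X.o e = f.onV a} :=
    f.onE.subtypeEquiv fun e => by rw [← f.map_o, f.onV.apply_eq_iff_eq]
  unfold divIndicator Aut.onDiv
  rw [AddEquiv.toAddMonoidHom_eq_coe, AddMonoidHom.coe_coe, AddEquiv.map_finsum,
    ← finsum_comp_equiv s]
  refine finsum_congr fun e => ?_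
  have hs : (s e).1 = f.onE e.1 := rfl
  rw [hs, ← f.map_t, map_sub]
  simp

theorem Aut.onDiv_mem_Pr {X : SerreGraph.{u, v}} (f : X.Aut) {D : X.Div} (hD : D ∈ X.Pr) :
    f.onDiv D ∈ X.Pr := by
  have h : X.Pr ≤ X.Pr.comap f.onDiv := by
    unfold Pr
    rw [AddSubgroup.closure_le]
    rintro _ ⟨a, rfl⟩
    exact AddSubgroup.subset_closure ⟨f.onV a, (f.onDiv_divIndicator a).symm⟩
  exact h hD

/-- The action of an automorphism on `Div⁰`. -/
noncomputable def Aut.onDiv0 {X : SerreGraph.{u, v}} (f : X.Aut) : X.Div0 →+ X.Div0 :=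
  (f.onDiv.comp X.Div0.subtype).codRestrict X.Div0 fun D => f.onDiv_mem_Div0 D.2

/-- The action of an automorphism on `Jac`, `[D] ↦ [f(D)]`. -/
noncomputable def Aut.onJac {X : SerreGraph.{u, v}} (f : X.Aut) : X.Jac →+ X.Jac :=
  QuotientAddGroup.map _ _ f.onDiv0 fun _ hD => f.onDiv_mem_Pr hD

theorem Aut.onJac_mk {X : SerreGraph.{u, v}} (f : X.Aut) (D : X.Div0) :
    f.onJac (Jac.mk X D) = Jac.mk X (f.onDiv0 D) := rfl

/-- `Jac(X)` as a `ℤ[Aut(X)]`-module. -/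
noncomputable def jacRep (X : SerreGraph.{u, v}) : Representation ℤ X.Aut X.Jac where
  toFun f := f.onJac.toIntLinearMap
  map_one' := by
    refine LinearMap.ext fun y => ?_
    obtain ⟨D, rfl⟩ := QuotientAddGroup.mk_surjective y
    change Jac.mk X (Aut.onDiv0 1 D) = Jac.mk X D
    congr 1
    refine Subtype.ext ?_
    change Finsupp.domCongr (Equiv.refl _) D.1 = D.1
    ext
    simp
  map_mul' f g := by
    refine LinearMap.ext fun y => ?_
    obtain ⟨D, rfl⟩ := QuotientAddGroup.mk_surjective y
    change Jac.mk X (Aut.onDiv0 (f * g) D) = Jac.mk X (f.onDiv0 (g.onDiv0 D))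
    congr 1
    refine Subtype.ext ?_
    change Finsupp.domCongr (g.onV.trans f.onV) D.1 =
      Finsupp.domCongr f.onV (Finsupp.domCongr g.onV D.1)
    ext
    simp

/-! ### Planar embeddings and dual graphs -/

/-- An embedding of a finite connected graph in the oriented sphere, given combinatorially.
`rot` is the rotation system: it sends a dart to the next dart, counterclockwise, with the same
origin. Walking along a dart `e` with a face on the left-hand side, the next boundary dart of that
face is the one which precedes `inv e` in the counterclockwise order at `t e`, that is
`rot⁻¹ (inv e)`; the faces are therefore the cycles of `e ↦ rot⁻¹ (inv e)`, and `left e` is the face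
to the left of `e`. A graph without darts still has a face. The embedding is into the sphere (rather
than into a surface of higher genus) by Euler's formula `#V - #E/2 + #F = 2`. -/
structure PlanarEmbedding (X : SerreGraph.{u, v}) where
  rot : Equiv.Perm X.E
  rot_cycles : ∀ e e' : X.E, rot.SameCycle e e' ↔ X.o e = X.o e'
  Face : Type w
  left : X.E → Face
  left_eq_iff : ∀ e e' : X.E, left e = left e' ↔
    Relation.EqvGen (fun a b => b = rot.symm (X.inv a)) e e'
  left_surj : ∀ f : Face, IsEmpty X.E ∨ ∃ e, left e = f
  finite_face : Finite Face
  euler : 2 * Nat.card X.V + 2 * Nat.card Face = Nat.card X.E + 4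

/-- The dual graph of an embedded graph: its vertices are the faces, and a dart `e` gives the dual
dart `e^∨`, which crosses `e` from left to right. -/
def PlanarEmbedding.dual {X : SerreGraph.{u, v}} (P : PlanarEmbedding.{u, v, w} X) :
    SerreGraph.{w, v} where
  V := P.Face
  E := X.E
  o e := P.left e
  t e := P.left (X.inv e)
  inv := X.inv
  inv_ne := X.inv_ne
  inv_inv := X.inv_inv
  o_inv _ := rfl
  t_inv e := by rw [X.inv_inv]

/-- The tautological bijection `e ↦ e^∨` from the darts of a graph to those of its dual. -/
def PlanarEmbedding.dualDart {X : SerreGraph.{u, v}} (P : PlanarEmbedding.{u, v, w} X) :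
    X.E ≃ P.dual.E := Equiv.refl X.E

/-! ### Dart assignments -/

/-- Dart assignments: `φ(e) + φ(ē) = 0`. -/
def DartAssignment (X : SerreGraph.{u, v}) : Type v :=
  {φ : X.E → ℤ // ∀ e, φ e + φ (X.inv e) = 0}

theorem finsum_dart_mem_ker {A : Type w} {X : SerreGraph.{u, v}} (φ : X.DartAssignment)
    (c : X.E → A) :
    Finsupp.liftAddHom (fun _ => AddMonoidHom.id ℤ)
      (∑ᶠ e : X.E, Finsupp.single (c e) (φ.1 e)) = (0 : ℤ) := by
  by_cases h : (Function.support fun e : X.E => Finsupp.single (c e) (φ.1 e)).Finite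
  · rw [AddMonoidHom.map_finsum _ h]
    simp only [Finsupp.liftAddHom_apply_single, AddMonoidHom.id_apply]
    let i : X.E ≃ X.E := ⟨X.inv, X.inv, X.inv_inv, X.inv_inv⟩
    have h1 : ∑ᶠ e, φ.1 (i e) = ∑ᶠ e, φ.1 e := finsum_comp_equiv i
    have h2 : ∑ᶠ e, φ.1 (i e) = - ∑ᶠ e, φ.1 e := by
      rw [← finsum_neg_distrib]
      exact finsum_congr fun e => by
        have := φ.2 e
        change φ.1 (X.inv e) = _
        linarith
    linarith
  · rw [finsum_of_infinite_support h, map_zero]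

/-- The vertex configuration `∂φ = ∑_v ∑_{e ∈ E^o_v} φ(e) v = ∑_e φ(e) o(e)` of a dart assignment on
a finite graph; its degree is zero because `φ` is antisymmetric. -/
noncomputable def vertexConfig {X : SerreGraph.{u, v}} (φ : X.DartAssignment) : X.Div0 :=
  ⟨∑ᶠ e : X.E, Finsupp.single (X.o e) (φ.1 e), finsum_dart_mem_ker φ X.o⟩

/-- The face configuration `∂*φ = ∑_f ∑_{e ∈ f°} φ(e) f = ∑_e φ(e) left(e)` of a dart assignment on
a finite embedded graph, where the counterclockwise boundary `f°` of `f` consists of the darts with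
`f` on their left-hand side. -/
noncomputable def PlanarEmbedding.faceConfig {X : SerreGraph.{u, v}}
    (P : PlanarEmbedding.{u, v, w} X) (φ : X.DartAssignment) : P.dual.Div0 :=
  ⟨∑ᶠ e : X.E, Finsupp.single (P.left e) (φ.1 e), finsum_dart_mem_ker φ P.left⟩

/-! ### Derived graphs of voltage assignments -/

/-- The derived graph `X(G, I, α)`: vertices `⨆_v {v} × G/I_v`, darts `E × G`, where `(e, g)` goes
from `(o e, g I_{o e})` to `(t e, g α(e) I_{t e})`, and the inverse of `(e, g)` is `(ē, g α(e))`. -/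
def derived (X : SerreGraph.{u, v}) {G : Type w} [Group G] (I : X.V → Subgroup G) (α : X.E → G)
    (hα : ∀ e, α (X.inv e) = (α e)⁻¹) : SerreGraph.{max u w, max v w} where
  V := Σ a : X.V, G ⧸ I a
  E := X.E × G
  o e := ⟨X.o e.1, (e.2 : G)⟩
  t e := ⟨X.t e.1, (e.2 * α e.1 : G)⟩
  inv e := (X.inv e.1, e.2 * α e.1)
  inv_ne e h := X.inv_ne e.1 (congrArg Prod.fst h)
  inv_inv e := by simp [X.inv_inv, hα]
  o_inv e := by
    change (⟨X.o (X.inv e.1), _⟩ : Σ a : X.V, G ⧸ I a) = _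
    rw [X.o_inv]
  t_inv e := by
    change (⟨X.t (X.inv e.1), ((e.2 * α e.1 * α (X.inv e.1) : G) : G ⧸ I (X.t (X.inv e.1)))⟩ :
      Σ a : X.V, G ⧸ I a) = _
    rw [X.t_inv, hα, mul_inv_cancel_right]

/-- The action of `G` on the derived graph: `h (a, g I_a) = (a, h g I_a)` on vertices and
`h (e, g) = (e, h g)` on darts. -/
def derivedAction (X : SerreGraph.{u, v}) {G : Type w} [Group G] (I : X.V → Subgroup G)
    (α : X.E → G) (hα : ∀ e, α (X.inv e) = (α e)⁻¹) : G →* (X.derived I α hα).Aut where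
  toFun h := ⟨Equiv.sigmaCongrRight fun _ => MulAction.toPerm h,
    Equiv.prodCongrRight fun _ => Equiv.mulLeft h, fun _ => rfl,
    fun e => Prod.ext rfl (mul_assoc h e.2 (α e.1)).symm⟩
  map_one' := Iso.ext
    (Equiv.ext fun y => Sigma.ext rfl (heq_of_eq (one_smul G y.2)))
    (Equiv.ext fun e => Prod.ext rfl (one_mul e.2))
  map_mul' h k := Iso.ext
    (Equiv.ext fun y => Sigma.ext rfl (heq_of_eq (mul_smul h k y.2)))
    (Equiv.ext fun e => Prod.ext rfl (mul_assoc h k e.2))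

end SerreGraph

/-! ### Uniform pro-`p` groups -/

/-- `𝒢^{p^n}`: the subgroup generated by the `p^n`-th powers. -/
def powSubgroup (𝒢 : Type w) [Group 𝒢] (p n : ℕ) : Subgroup 𝒢 :=
  Subgroup.closure (Set.range fun g : 𝒢 => g ^ p ^ n)

instance powSubgroup_normal (𝒢 : Type w) [Group 𝒢] (p n : ℕ) : (powSubgroup 𝒢 p n).Normal := by
  refine ⟨fun a ha g => ?_⟩
  have h : powSubgroup 𝒢 p n ≤ (powSubgroup 𝒢 p n).comap (MulAut.conj g).toMonoidHom := by
    refine (Subgroup.closure_le _).2 ?_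
    rintro _ ⟨b, rfl⟩
    refine Subgroup.subset_closure ⟨g * b * g⁻¹, ?_⟩
    change (MulAut.conj g b) ^ p ^ n = MulAut.conj g (b ^ p ^ n)
    rw [map_pow]
  exact h ha

/-- Uniform pro-`p` groups of dimension `d`: topologically finitely generated (by `d` elements),
powerful pro-`p` groups all of whose successive quotients `𝒢^{p^n} / 𝒢^{p^(n+1)}` are isomorphic to
`(ℤ/p)^d`. -/
structure IsUniformProP (p d : ℕ) (𝒢 : Type w) [Group 𝒢] [TopologicalSpace 𝒢] : Prop where
  isTopologicalGroup : IsTopologicalGroup 𝒢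
  compact : CompactSpace 𝒢
  t2 : T2Space 𝒢
  totallyDisconnected : TotallyDisconnectedSpace 𝒢
  index_open : ∀ U : Subgroup 𝒢, U.Normal → IsOpen (U : Set 𝒢) → ∃ k : ℕ, U.index = p ^ k
  generated : ∃ s : Fin d → 𝒢, Dense (Subgroup.closure (Set.range s) : Set 𝒢)
  powerful : ∀ a b : 𝒢,
    a * b * a⁻¹ * b⁻¹ ∈ closure (powSubgroup 𝒢 p (if p = 2 then 2 else 1) : Set 𝒢)
  uniform : ∀ n : ℕ, Nonempty
    ((powSubgroup 𝒢 p n ⧸ (powSubgroup 𝒢 p (n + 1)).subgroupOf (powSubgroup 𝒢 p n)) ≃*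
      Multiplicative (Fin d → ZMod p))

/-! ### Branched `𝒢`-towers -/

/-- The finite quotient `𝒢_n = 𝒢 / 𝒢^{p^n}`. -/
abbrev layerGroup (𝒢 : Type w) [Group 𝒢] (p n : ℕ) : Type w := 𝒢 ⧸ powSubgroup 𝒢 p n

/-- The data defining a `𝒢`-tower over `X`: a voltage assignment with values in `𝒢` and a closed
subgroup `I_v` of `𝒢` for every vertex `v`. -/
structure TowerData (𝒢 : Type w) [Group 𝒢] [TopologicalSpace 𝒢] (X : SerreGraph.{u, v}) where
  α : X.E → 𝒢
  α_inv : ∀ e, α (X.inv e) = (α e)⁻¹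
  I : X.V → Subgroup 𝒢
  I_closed : ∀ a, IsClosed (I a : Set 𝒢)

namespace TowerData

variable {𝒢 : Type w} [Group 𝒢] [TopologicalSpace 𝒢] {X : SerreGraph.{u, v}}

theorem layer_inv (T : TowerData 𝒢 X) (p n : ℕ) (e : X.E) :
    QuotientGroup.mk' (powSubgroup 𝒢 p n) (T.α (X.inv e)) =
      (QuotientGroup.mk' (powSubgroup 𝒢 p n) (T.α e))⁻¹ := by
  rw [T.α_inv, map_inv]

/-- The `n`-th layer `X_n = X(𝒢_n, π_n(I), π_n ∘ α)`. -/
def layer (T : TowerData 𝒢 X) (p n : ℕ) : SerreGraph.{max u w, max v w} :=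
  X.derived (fun a => (T.I a).map (QuotientGroup.mk' (powSubgroup 𝒢 p n)))
    (fun e => QuotientGroup.mk' (powSubgroup 𝒢 p n) (T.α e)) (T.layer_inv p n)

/-- The Galois action of `𝒢_n` on `X_n`. -/
def galois (T : TowerData 𝒢 X) (p n : ℕ) : layerGroup 𝒢 p n →* (T.layer p n).Aut :=
  X.derivedAction _ _ (T.layer_inv p n)

end TowerData

/-- "The dual graphs `X_n^∨` form a `𝒢`-tower as well": the graphs `X_n^∨` (for the chosen planar
embeddings `P n` of the `X_n`) are identified with the layers of a `𝒢`-tower over the dual graph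
`X_0^∨` of the base, and the Galois action of `𝒢_n` is compatible with taking duals,
`g · e^∨ = (g · e)^∨`. -/
structure DualTower {𝒢 : Type w} [Group 𝒢] [TopologicalSpace 𝒢] {X : SerreGraph.{u, v}} {p : ℕ}
    (T : TowerData 𝒢 X)
    (P : ∀ n, SerreGraph.PlanarEmbedding.{max u w, max v w, x} (T.layer p n)) where
  tower : TowerData 𝒢 (P 0).dual
  iso : ∀ n, SerreGraph.Iso (P n).dual (tower.layer p n)
  galois_dualDart : ∀ (n : ℕ) (g : layerGroup 𝒢 p n) (e : (T.layer p n).E),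
    ((iso n).conj (tower.galois p n g)).onE ((P n).dualDart e) =
      (P n).dualDart ((T.galois p n g).onE e)

/-- The Galois action of `𝒢_n` on `X_n^∨`, as a layer of the dual tower. -/
def DualTower.galois {𝒢 : Type w} [Group 𝒢] [TopologicalSpace 𝒢] {X : SerreGraph.{u, v}} {p : ℕ}
    {T : TowerData 𝒢 X}
    {P : ∀ n, SerreGraph.PlanarEmbedding.{max u w, max v w, x} (T.layer p n)}
    (D : DualTower T P) (n : ℕ) : layerGroup 𝒢 p n →* (P n).dual.Aut :=
  (D.iso n).conj.comp (D.tower.galois p n)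

/-! Let C be the lattice of dart assignments on a connected planar graph, with its sublattices B of
coboundaries (cuts) and Z = ker ∂ (cycles). Connectedness makes ∂ : C → Div⁰ surjective
(`Connected.boundary_surjective`), and Pr = ∂B (`mem_Pr_iff`), so Jac = C/(B + Z)
(`Jac.mk_boundary_eq_zero_iff`).

The dual graph has the same darts and the same inversion, hence literally the same C, and its
boundary operator is ∂*. Duality exchanges the two sublattices: the cuts of the dual are the cycles
of the graph (`range_coboundary_dual`), and the cycles of the dual are the cuts of the graph
(`range_coboundary`). In each case one inclusion is a local computation with the rotation system.
Euler's formula makes the ranks agree, and cuts are saturated in C, so the inclusion is an equality.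
Both Jacobians are thus the quotient of C by B + Z, and θ is induced by the identity of C.

Equivariance follows because an automorphism and its dual permute the darts in the same way. The
tower contributes only finiteness of the layers and the compatibility of the Galois actions. -/

/-- A submodule of full rank, the quotient by which is torsion-free, is everything. -/
theorem Submodule.eq_of_le_of_finrank_eq_of_saturated {M : Type*} [AddCommGroup M]
    {N K : Submodule ℤ M} [Module.Finite ℤ K] (hNK : N ≤ K)
    (hrank : Module.finrank ℤ N = Module.finrank ℤ K)
    (hsat : ∀ (m : ℤ) (y : M), m ≠ 0 → m • y ∈ N → y ∈ N) : N = K := by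
  refine le_antisymm hNK fun y hy => ?_
  have h1 := Submodule.finrank_quotient_add_finrank (N.comap K.subtype)
  have h2 : Module.finrank ℤ (N.comap K.subtype) = Module.finrank ℤ N :=
    (Submodule.comapSubtypeEquivOfLe hNK).finrank_eq
  -- Rank zero means that K/N is torsion, so a nonzero multiple of `y` lies in N.
  have h3 : Module.finrank ℤ (K ⧸ N.comap K.subtype) = 0 := by omega
  obtain ⟨m, hm, h⟩ := Module.finrank_eq_zero_iff.1 h3 (Submodule.Quotient.mk ⟨y, hy⟩)
  rw [← Submodule.Quotient.mk_smul, Submodule.Quotient.mk_eq_zero] at h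
  exact hsat m y hm h

theorem LinearMap.finrank_range_add_finrank_ker_int {M N : Type*} [AddCommGroup M]
    [AddCommGroup N] [Module.Finite ℤ M] (f : M →ₗ[ℤ] N) :
    Module.finrank ℤ (LinearMap.range f) + Module.finrank ℤ (LinearMap.ker f) =
      Module.finrank ℤ M := by
  rw [← Submodule.finrank_quotient_add_finrank (LinearMap.ker f),
    f.quotKerEquivRange.finrank_eq]

namespace SerreGraph

variable {X : SerreGraph.{u, v}}

/-! ### Propagation along darts and reindexing by inversion -/

/-- Induction along paths: this gives surjectivity of ∂, constancy of functions with zero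
coboundary, saturation of cuts, and connectedness of the dual. -/
theorem Connected.mem_of_mem (hX : X.Connected) {S : Set X.V}
    (hS : ∀ e, X.o e ∈ S → X.t e ∈ S) {a : X.V} (ha : a ∈ S) (b : X.V) : b ∈ S := by
  induction hX.2 a b with
  | refl => exact ha
  | tail _ h ih =>
    obtain ⟨e, rfl, rfl⟩ := h
    exact hS e ih

theorem Connected.apply_eq {β : Type*} (hX : X.Connected) (g : X.V → β)
    (hg : ∀ e, g (X.o e) = g (X.t e)) (a b : X.V) : g b = g a :=
  hX.mem_of_mem (S := {b | g b = g a}) (fun e he => (hg e).symm.trans he) rfl b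

/-- Inversion, as a permutation of the darts. -/
def invEquiv (X : SerreGraph.{u, v}) : X.E ≃ X.E := ⟨X.inv, X.inv, X.inv_inv, X.inv_inv⟩

theorem finsum_comp_inv {A : Type*} [AddCommMonoid A] (f : X.E → A) :
    ∑ᶠ e, f (X.inv e) = ∑ᶠ e, f e :=
  finsum_comp_equiv X.invEquiv

/-! ### The boundary and coboundary operators -/

/-- The module of dart assignments. -/
def dartModule (X : SerreGraph.{u, v}) : Submodule ℤ (X.E → ℤ) where
  carrier := {φ | ∀ e, φ e + φ (X.inv e) = 0}
  add_mem' {φ ψ} hφ hψ e := by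
    have := hφ e
    have := hψ e
    simp only [Pi.add_apply]
    linarith
  zero_mem' _ := by simp
  smul_mem' m φ hφ e := by
    simp only [Pi.smul_apply, smul_eq_mul, ← mul_add, hφ e, mul_zero]

/-- The boundary operator `φ ↦ ∂φ`. -/
noncomputable def boundary (X : SerreGraph.{u, v}) [Finite X.E] : X.dartModule →ₗ[ℤ] X.Div0 :=
  AddMonoidHom.toIntLinearMap <| AddMonoidHom.mk' (fun φ => vertexConfig ⟨φ.1, φ.2⟩)
    fun φ ψ => Subtype.ext <| by
      change ∑ᶠ e : X.E, Finsupp.single (X.o e) (φ.1 e + ψ.1 e) =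
        ∑ᶠ e : X.E, Finsupp.single (X.o e) (φ.1 e) + ∑ᶠ e : X.E, Finsupp.single (X.o e) (ψ.1 e)
      rw [← finsum_add_distrib (Set.toFinite _) (Set.toFinite _)]
      simp only [Finsupp.single_add]

theorem coe_boundary [Finite X.E] (φ : X.dartModule) :
    (X.boundary φ : X.Div) = ∑ᶠ e : X.E, Finsupp.single (X.o e) (φ.1 e) := rfl

/-- The coboundary operator, which sends a function on the vertices to its differences along the
darts. -/
def coboundary (X : SerreGraph.{u, v}) : (X.V → ℤ) →ₗ[ℤ] X.dartModule where
  toFun g := ⟨fun e => g (X.o e) - g (X.t e), fun e => by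
    change g (X.o e) - g (X.t e) + (g (X.o (X.inv e)) - g (X.t (X.inv e))) = 0
    rw [X.o_inv, X.t_inv]
    ring⟩
  map_add' g h := Subtype.ext <| funext fun e => by
    change g (X.o e) + h (X.o e) - (g (X.t e) + h (X.t e)) =
      g (X.o e) - g (X.t e) + (h (X.o e) - h (X.t e))
    ring
  map_smul' m g := Subtype.ext <| funext fun e => by
    change m * g (X.o e) - m * g (X.t e) = m * (g (X.o e) - g (X.t e))
    ring

theorem coe_coboundary (g : X.V → ℤ) (e : X.E) :
    (X.coboundary g).1 e = g (X.o e) - g (X.t e) := rfl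

/-- Reindexing by inversion moves the second half of an antisymmetrization to the other end of the
dart. A coboundary has this shape with `h e = g (X.o e)`, so this is the common start of the
boundary computations below. -/
theorem finsum_single_sub_inv [Finite X.E] {A : Type*} (c : X.E → A) (h : X.E → ℤ) :
    ∑ᶠ e : X.E, Finsupp.single (c e) (h e - h (X.inv e)) =
      ∑ᶠ e : X.E, Finsupp.single (c e) (h e) - ∑ᶠ e : X.E, Finsupp.single (c (X.inv e)) (h e) := by
  have h := finsum_comp_inv fun e : X.E => Finsupp.single (c (X.inv e)) (h e)
  simp only [X.inv_inv] at h
  rw [← h, ← finsum_sub_distrib (Set.toFinite _) (Set.toFinite _)]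
  simp only [Finsupp.single_sub]

theorem boundary_coboundary [Finite X.E] (g : X.V → ℤ) :
    (X.boundary (X.coboundary g) : X.Div) =
      ∑ᶠ e : X.E, Finsupp.single (X.o e) (g (X.o e)) -
        ∑ᶠ e : X.E, Finsupp.single (X.t e) (g (X.o e)) := by
  have h := finsum_single_sub_inv X.o fun e => g (X.o e)
  simp only [X.o_inv] at h
  exact h

open Classical in
theorem boundary_coboundary_single [Finite X.E] (a : X.V) :
    (X.boundary (X.coboundary (Pi.single a 1)) : X.Div) = X.divIndicator a := by
  rw [boundary_coboundary, divIndicator, ← finsum_sub_distrib (Set.toFinite _) (Set.toFinite _)]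
  -- The sum over the darts leaving `a` becomes a sum over all darts of an indicator function.
  have h := finsum_mem_def {e | X.o e = a}
    fun e => (Finsupp.single a 1 - Finsupp.single (X.t e) 1 : X.Div)
  rw [← finsum_set_coe_eq_finsum_mem] at h
  refine Eq.trans (finsum_congr fun e => ?_) h.symm
  by_cases he : X.o e = a
  · rw [Set.indicator_of_mem (s := {e | X.o e = a}) he, he, Pi.single_eq_same]
  · rw [Set.indicator_of_notMem (s := {e | X.o e = a}) he, Pi.single_eq_of_ne he]
    simp

open Classical in
-- The elementary assignment of a dart, its indicator minus that of its inverse; in a connected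
-- graph the resulting differences generate Div⁰.
theorem exists_boundary_eq_single_sub_single [Finite X.E] (e : X.E) : ∃ φ : X.dartModule,
    (X.boundary φ : X.Div) = Finsupp.single (X.o e) 1 - Finsupp.single (X.t e) 1 := by
  refine ⟨⟨fun e' => (Pi.single e 1 : X.E → ℤ) e' - (Pi.single e 1 : X.E → ℤ) (X.inv e'),
    fun e' => ?_⟩, ?_⟩
  · change (Pi.single e 1 : X.E → ℤ) e' - (Pi.single e 1 : X.E → ℤ) (X.inv e') +
      ((Pi.single e 1 : X.E → ℤ) (X.inv e') - (Pi.single e 1 : X.E → ℤ) (X.inv (X.inv e'))) = 0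
    rw [X.inv_inv]
    ring
  · refine (finsum_single_sub_inv X.o _).trans ?_
    have hc (c : X.E → X.V) :
        ∑ᶠ e' : X.E, Finsupp.single (c e') ((Pi.single e 1 : X.E → ℤ) e') =
          Finsupp.single (c e) 1 := by
      rw [finsum_eq_single _ e fun e' he => by rw [Pi.single_eq_of_ne he, Finsupp.single_zero],
        Pi.single_eq_same]
    rw [hc, hc fun e => X.o (X.inv e), X.o_inv]

theorem Connected.boundary_surjective [Finite X.E] (hX : X.Connected) :
    Function.Surjective X.boundary := by
  obtain ⟨a⟩ := hX.1
  let S : AddSubgroup X.Div := ((X.Div0.subtype).comp X.boundary.toAddMonoidHom).range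
  have hS (b : X.V) : (Finsupp.single b 1 : X.Div) - Finsupp.single a 1 ∈ S := by
    refine hX.mem_of_mem (S := {b | (Finsupp.single b 1 : X.Div) - Finsupp.single a 1 ∈ S})
      (fun e he => ?_) (a := a) ?_ b
    · have h : (Finsupp.single (X.o e) 1 : X.Div) - Finsupp.single (X.t e) 1 ∈ S :=
        exists_boundary_eq_single_sub_single e
      have := S.sub_mem he h
      rwa [sub_sub_sub_cancel_left] at this
    · change (Finsupp.single a 1 : X.Div) - Finsupp.single a 1 ∈ S
      rw [sub_self]
      exact S.zero_mem
  -- Correcting by the degree at the base vertex gives a statement about all divisors, additive in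
  -- `D`, which can be checked on single vertices.
  have hD (D : X.Div) : D - Finsupp.single a (X.deg D) ∈ S := by
    induction D using Finsupp.induction_linear with
    | zero => simp
    | add D D' h h' =>
      have := S.add_mem h h'
      rwa [sub_add_sub_comm, ← Finsupp.single_add, ← map_add] at this
    | single b m =>
      have := S.zsmul_mem (hS b) m
      simpa [deg, smul_sub] using this
  intro D
  have := hD D.1
  rw [show X.deg D.1 = 0 from D.2, Finsupp.single_zero, sub_zero] at this
  obtain ⟨φ, hφ⟩ := this
  exact ⟨φ, Subtype.ext hφ⟩

/-! ### Ranks and saturation of cuts and cycles -/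

theorem finrank_dartModule [Finite X.E] :
    2 * Module.finrank ℤ X.dartModule = Nat.card X.E := by
  classical
  have := Fintype.ofFinite X.E
  -- An arbitrary order orients each edge: `e < X.inv e` selects one dart of each pair, and its
  -- value is free.
  obtain ⟨r, hr⟩ : ∃ r : LinearOrder X.E, True :=
    ⟨LinearOrder.lift' (Fintype.equivFin X.E) (Fintype.equivFin X.E).injective, trivial⟩
  have key : X.dartModule ≃ₗ[ℤ] ({e : X.E // e < X.inv e} → ℤ) :=
    { toFun := fun φ e => φ.1 e
      map_add' := fun _ _ => rfl
      map_smul' := fun _ _ => rfl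
      -- The final value 0 is never reached, since a dart differs from its inverse.
      invFun := fun f => ⟨fun e => if h : e < X.inv e then f ⟨e, h⟩ else
          if h : X.inv e < X.inv (X.inv e) then - f ⟨X.inv e, h⟩ else 0, fun e => by
            have := X.inv_inv e
            rcases lt_or_gt_of_ne (X.inv_ne e) with h | h
            · have h' := h.not_gt
              simp [h, h', X.inv_inv]
            · have h' := h.not_gt
              simp [h, h', X.inv_inv]⟩
      left_inv := fun φ => Subtype.ext <| funext fun e => by
        have h0 := φ.2 e
        rcases lt_or_gt_of_ne (X.inv_ne e) with h | h
        · have h' := h.not_gt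
          simp only [h', h, X.inv_inv, dite_true, dite_false]
          linarith
        · simp [h]
      right_inv := fun f => funext fun e => by simp [e.2] }
  rw [key.finrank_eq, Module.finrank_fintype_fun_eq_card, Nat.card_eq_fintype_card, two_mul,
    ← Fintype.card_congr (Equiv.sumCompl fun e : X.E => e < X.inv e), Fintype.card_sum]
  congr 1
  refine Fintype.card_congr (X.invEquiv.subtypeEquiv fun e => ?_)
  change e < X.inv e ↔ ¬ X.inv e < X.inv (X.inv e)
  rw [X.inv_inv, not_lt]
  exact ⟨le_of_lt, fun h => lt_of_le_of_ne h (X.inv_ne e).symm⟩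

theorem finrank_Div0 [Finite X.V] [Nonempty X.V] :
    Module.finrank ℤ X.Div0 + 1 = Nat.card X.V := by
  have := Fintype.ofFinite X.V
  have h := LinearMap.finrank_range_add_finrank_ker_int X.deg.toIntLinearMap
  have hr : LinearMap.range X.deg.toIntLinearMap = ⊤ := LinearMap.range_eq_top.2 fun m => by
    inhabit X.V
    exact ⟨Finsupp.single default m, by simp [deg]⟩
  rw [hr, finrank_top, Module.finrank_self, Module.finrank_finsupp_self,
    ← Nat.card_eq_fintype_card, add_comm] at h
  exact h

/-- The first Betti number #E/2 - #V + 1, by rank-nullity for the surjection ∂; doubled to avoid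
division and subtraction. -/
theorem Connected.finrank_ker_boundary [Finite X.E] [Finite X.V] (hX : X.Connected) :
    2 * Module.finrank ℤ (LinearMap.ker X.boundary) + 2 * Nat.card X.V = Nat.card X.E + 2 := by
  have := hX.1
  have h := LinearMap.finrank_range_add_finrank_ker_int X.boundary
  rw [LinearMap.range_eq_top.2 hX.boundary_surjective, finrank_top] at h
  have := finrank_dartModule (X := X)
  have := finrank_Div0 (X := X)
  omega

/-- By connectedness the kernel consists of the constants, and evaluation at a base vertex
identifies it with ℤ. -/
theorem Connected.finrank_range_coboundary [Finite X.V] (hX : X.Connected) :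
    Module.finrank ℤ (LinearMap.range X.coboundary) + 1 = Nat.card X.V := by
  have := Fintype.ofFinite X.V
  have h := LinearMap.finrank_range_add_finrank_ker_int X.coboundary
  obtain ⟨a⟩ := hX.1
  let key : LinearMap.ker X.coboundary ≃ₗ[ℤ] ℤ :=
    { toFun := fun g => g.1 a
      map_add' := fun _ _ => rfl
      map_smul' := fun _ _ => rfl
      invFun := fun m => ⟨fun _ => m, LinearMap.mem_ker.2 <|
        Subtype.ext <| funext fun e => sub_self m⟩
      left_inv := fun g => Subtype.ext <| funext fun b =>
        (hX.apply_eq g.1 (fun e => sub_eq_zero.1 (congrFun (congrArg Subtype.val g.2) e)) a b).symm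
      right_inv := fun _ => rfl }
  rw [key.finrank_eq, Module.finrank_self, Module.finrank_fintype_fun_eq_card,
    ← Nat.card_eq_fintype_card] at h
  exact h

/-- Coboundaries of a connected graph form a saturated subgroup. -/
theorem Connected.mem_range_coboundary_of_smul_mem (hX : X.Connected) (m : ℤ)
    (φ : X.dartModule) (hm : m ≠ 0) (h : m • φ ∈ LinearMap.range X.coboundary) :
    φ ∈ LinearMap.range X.coboundary := by
  obtain ⟨g, hg⟩ := h
  obtain ⟨a⟩ := hX.1
  have hg' (e : X.E) : g (X.o e) - g (X.t e) = m * φ.1 e :=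
    congrFun (congrArg Subtype.val hg) e
  -- Increments of `g` along darts are multiples of `m`, so `g` is constant modulo `m`; the function
  -- (g - g a)/m then has coboundary φ.
  have hdvd (b : X.V) : m ∣ g b - g a :=
    hX.mem_of_mem (S := {b | m ∣ g b - g a}) (fun e he => by
      have : g (X.t e) - g a = g (X.o e) - g a - m * φ.1 e := by rw [← hg']; ring
      change m ∣ g (X.t e) - g a
      rw [this]
      exact dvd_sub he (dvd_mul_right _ _)) (a := a) (by simp) b
  choose k hk using hdvd
  refine ⟨k, Subtype.ext <| funext fun e => mul_left_cancel₀ hm ?_⟩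
  rw [coe_coboundary, ← hg', mul_sub, ← hk, ← hk]
  ring

/-! ### The Jacobian as a quotient of the dart assignments -/

/-- Principal divisors are the boundaries of coboundaries. -/
theorem mem_Pr_iff [Finite X.E] [Finite X.V] (D : X.Div) :
    D ∈ X.Pr ↔ ∃ g : X.V → ℤ, (X.boundary (X.coboundary g) : X.Div) = D := by
  classical
  have := Fintype.ofFinite X.V
  let L : (X.V → ℤ) →+ X.Div :=
    (X.Div0.subtype).comp (X.boundary ∘ₗ X.coboundary).toAddMonoidHom
  have hL (a : X.V) : L (Pi.single a 1) = X.divIndicator a := boundary_coboundary_single a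
  have hr : X.Pr = L.range := by
    refine le_antisymm ((AddSubgroup.closure_le _).2 ?_) ?_
    · rintro _ ⟨a, rfl⟩
      exact ⟨Pi.single a 1, hL a⟩
    · rintro _ ⟨g, rfl⟩
      rw [← Finset.univ_sum_single g, map_sum]
      refine AddSubgroup.sum_mem _ fun a _ => ?_
      have h : (Pi.single a (g a) : X.V → ℤ) = g a • Pi.single a 1 := by
        rw [← Pi.single_smul, smul_eq_mul, mul_one]
      rw [h, map_zsmul, hL]
      exact AddSubgroup.zsmul_mem _ (AddSubgroup.subset_closure (Set.mem_range_self a)) _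
  rw [hr]
  rfl

/-- ∂φ is principal exactly when it equals the boundary of a coboundary, that is, when φ differs
from a cut by a cycle. -/
theorem Jac.mk_boundary_eq_zero_iff [Finite X.E] [Finite X.V] (φ : X.dartModule) :
    Jac.mk X (X.boundary φ) = 0 ↔
      φ ∈ LinearMap.range X.coboundary ⊔ LinearMap.ker X.boundary := by
  have h : Jac.mk X (X.boundary φ) = 0 ↔ (X.boundary φ : X.Div) ∈ X.Pr :=
    QuotientAddGroup.eq_zero_iff _
  rw [h, mem_Pr_iff, Submodule.mem_sup]
  constructor
  · rintro ⟨g, hg⟩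
    refine ⟨X.coboundary g, ⟨g, rfl⟩, φ - X.coboundary g, ?_, by abel⟩
    rw [LinearMap.mem_ker, map_sub, sub_eq_zero]
    exact Subtype.ext hg.symm
  · rintro ⟨_, ⟨g, rfl⟩, ψ, hψ, rfl⟩
    refine ⟨g, ?_⟩
    rw [map_add, LinearMap.mem_ker.1 hψ, add_zero]

theorem Aut.onDiv0_vertexConfig [Finite X.E] (f : X.Aut) (φ ψ : X.DartAssignment)
    (h : ∀ e, ψ.1 (f.onE e) = φ.1 e) : f.onDiv0 (vertexConfig φ) = vertexConfig ψ := by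
  refine Subtype.ext ?_
  change f.onDiv (∑ᶠ e : X.E, Finsupp.single (X.o e) (φ.1 e)) =
    ∑ᶠ e : X.E, Finsupp.single (X.o e) (ψ.1 e)
  rw [AddMonoidHom.map_finsum _ (Set.toFinite _),
    ← finsum_comp_equiv f.onE (f := fun e => Finsupp.single (X.o e) (ψ.1 e))]
  exact finsum_congr fun e => by rw [Aut.onDiv_single, f.map_o, h]

/-! ### Planar duality -/

namespace PlanarEmbedding

variable (P : PlanarEmbedding.{u, v, w} X)

theorem o_rot_symm (e : X.E) : X.o (P.rot.symm e) = X.o e := by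
  rw [← P.rot_cycles]
  exact ⟨1, by simp⟩

/-- `P.rot.symm e` is the successor of `X.inv e` in the face walk. -/
theorem left_rot_symm (e : X.E) : P.left (P.rot.symm e) = P.left (X.inv e) := by
  rw [eq_comm, P.left_eq_iff]
  exact .rel _ _ (by rw [X.inv_inv])

/-- Crossing a dart passes from its left face to that of its inverse, which is also the left face of
the preceding dart in the rotation. So one can circle around a vertex through faces, and
connectedness of the graph carries this to every vertex. -/
theorem Connected.dual [Finite X.V] (hX : X.Connected) : P.dual.Connected := by
  -- Without darts there is a single vertex, and Euler's formula leaves exactly one face.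
  rcases isEmpty_or_nonempty X.E with hE | ⟨⟨e₀⟩⟩
  · have : Subsingleton X.V :=
      ⟨fun a b => hX.apply_eq id (fun e => hE.elim e) b a⟩
    have := hX.1
    have h1 : Nat.card X.V = 1 := Nat.card_unique
    have h := P.euler
    rw [h1, Nat.card_of_isEmpty (α := X.E)] at h
    obtain ⟨hs, ⟨f⟩⟩ := Nat.card_eq_one_iff_unique.1 (show Nat.card P.Face = 1 by omega)
    exact ⟨⟨f⟩, fun a b => hs.elim a b ▸ .refl⟩
  · refine ⟨⟨P.left e₀⟩, fun a b => ?_⟩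
    have hsurj (f : P.Face) : ∃ e, P.left e = f :=
      (P.left_surj f).resolve_left fun h => h.elim e₀
    obtain ⟨e₁, rfl⟩ := hsurj a
    obtain ⟨e₂, rfl⟩ := hsurj b
    let R : X.E → Prop := fun e => Relation.ReflTransGen
      (fun a b => ∃ e, P.dual.o e = a ∧ P.dual.t e = b) (P.left e₁) (P.left e)
    have hinv (e : X.E) (he : R e) : R (X.inv e) := he.tail ⟨e, rfl, rfl⟩
    have hrot_symm (e : X.E) (he : R e) : R (P.rot.symm e) := by
      change Relation.ReflTransGen _ _ (P.left _)
      rw [P.left_rot_symm]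
      exact hinv e he
    have hrot (e : X.E) (he : R e) : R (P.rot e) := by
      have h := P.left_rot_symm (P.rot e)
      rw [Equiv.symm_apply_apply] at h
      have := hinv (X.inv (P.rot e)) (by
        change Relation.ReflTransGen _ _ (P.left _)
        rw [← h]
        exact he)
      rwa [X.inv_inv] at this
    have hpow (e : X.E) (he : R e) (k : ℤ) : R ((P.rot ^ k) e) := by
      induction k with
      | zero => exact he
      | succ k ih =>
        rw [add_comm, zpow_add, zpow_one]
        exact hrot _ ih
      | pred k ih =>
        rw [sub_eq_neg_add, zpow_add, zpow_neg_one]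
        exact hrot_symm _ ih
    have hsame (e e' : X.E) (h : X.o e = X.o e') (he : R e) : R e' := by
      obtain ⟨k, rfl⟩ := (P.rot_cycles e e').2 h
      exact hpow e he k
    -- The propagated set consists of the vertices all of whose outgoing darts have a reachable left
    -- face.
    refine hX.mem_of_mem (S := {v | ∀ e, X.o e = v → R e}) (fun e he e' he' => ?_)
      (a := X.o e₁) (fun e he => hsame e₁ e he.symm .refl) (X.o e₂) e₂ rfl
    exact hsame (X.inv e) e' (by rw [X.o_inv, he']) (hinv e (he e rfl))

/-- The boundary of a face is a cycle. -/
theorem boundary_coboundary_dual [Finite X.E] (g : P.Face → ℤ) :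
    X.boundary (P.dual.coboundary g : X.dartModule) = 0 := by
  refine Subtype.ext ((finsum_single_sub_inv X.o fun e => g (P.left e)).trans (sub_eq_zero.2 ?_))
  -- Reindex by the face walk: it keeps the left face, and the next dart starts where the previous
  -- one ends.
  rw [← finsum_comp_equiv (X.invEquiv.trans P.rot.symm)]
  refine finsum_congr fun e => ?_
  change Finsupp.single (X.o (P.rot.symm (X.inv e))) (g (P.left (P.rot.symm (X.inv e)))) = _
  rw [o_rot_symm, left_rot_symm, X.inv_inv]

/-- The cut at a vertex is a cycle of the dual graph. -/
theorem dual_boundary_coboundary [Finite X.E] [Finite P.dual.E] (g : X.V → ℤ) :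
    P.dual.boundary (X.coboundary g : P.dual.dartModule) = 0 := by
  have h := finsum_single_sub_inv P.left fun e => g (X.o e)
  simp only [X.o_inv] at h
  refine Subtype.ext (h.trans (sub_eq_zero.2 ?_))
  -- Reindex by the rotation: it keeps the origin and replaces the left face of `e` by that of
  -- `X.inv e`.
  rw [← finsum_comp_equiv P.rot.symm]
  refine finsum_congr fun e => ?_
  rw [o_rot_symm, left_rot_symm]

/-- Every cycle of a connected planar graph is a sum of boundaries of faces. -/
theorem range_coboundary_dual [Finite X.V] [Finite X.E] (hX : X.Connected) :
    (LinearMap.range P.dual.coboundary : Submodule ℤ X.dartModule) = LinearMap.ker X.boundary := by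
  have hd : P.dual.Connected := Connected.dual P hX
  have : Finite P.dual.V := P.finite_face
  refine Submodule.eq_of_le_of_finrank_eq_of_saturated ?_ ?_
    hd.mem_range_coboundary_of_smul_mem
  · rintro _ ⟨g, rfl⟩
    exact P.boundary_coboundary_dual g
  -- Equality of ranks, #F - 1 = #E/2 - #V + 1, is Euler's formula.
  · have h1 := hX.finrank_ker_boundary
    have h2 : Module.finrank ℤ (LinearMap.range P.dual.coboundary) + 1 = Nat.card P.Face :=
      hd.finrank_range_coboundary
    have h3 := P.euler
    change Module.finrank ℤ (LinearMap.range P.dual.coboundary) = _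
    omega

/-- Every cycle of the dual of a connected planar graph is a sum of cuts at vertices. -/
theorem range_coboundary [Finite X.V] [Finite X.E] [Finite P.dual.E] (hX : X.Connected) :
    (LinearMap.range X.coboundary : Submodule ℤ P.dual.dartModule) =
      LinearMap.ker P.dual.boundary := by
  have hd : P.dual.Connected := Connected.dual P hX
  have : Finite P.dual.V := P.finite_face
  refine Submodule.eq_of_le_of_finrank_eq_of_saturated ?_ ?_
    hX.mem_range_coboundary_of_smul_mem
  · rintro _ ⟨g, rfl⟩
    exact P.dual_boundary_coboundary g
  · have h1 : 2 * Module.finrank ℤ (LinearMap.ker P.dual.boundary) + 2 * Nat.card P.Face =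
        Nat.card X.E + 2 := hd.finrank_ker_boundary
    have h2 := hX.finrank_range_coboundary
    have h3 := P.euler
    change Module.finrank ℤ (LinearMap.range X.coboundary) = _
    omega

/-- Planar duality of Jacobians: `[∂φ] ↦ [∂*φ]` is an isomorphism. -/
theorem exists_jac_equiv [Finite X.V] [Finite X.E] (hX : X.Connected) :
    ∃ θ : X.Jac ≃+ P.dual.Jac, ∀ φ : X.DartAssignment,
      θ (Jac.mk X (vertexConfig φ)) = Jac.mk P.dual (P.faceConfig φ) := by
  have : Finite P.dual.E := inferInstanceAs (Finite X.E)
  have : Finite P.dual.V := P.finite_face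
  let F : X.dartModule →+ X.Jac := (Jac.mk X).comp X.boundary.toAddMonoidHom
  let F' : X.dartModule →+ P.dual.Jac := (Jac.mk P.dual).comp P.dual.boundary.toAddMonoidHom
  have hF : Function.Surjective F :=
    (QuotientAddGroup.mk'_surjective _).comp hX.boundary_surjective
  have hF' : Function.Surjective F' :=
    (QuotientAddGroup.mk'_surjective _).comp (Connected.dual P hX).boundary_surjective
  -- Both kernels are B + Z, with the two summands interchanged by duality.
  have hker : F.ker = F'.ker := by
    ext φ
    have h1 : F φ = 0 ↔ φ ∈ LinearMap.range X.coboundary ⊔ LinearMap.ker X.boundary :=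
      Jac.mk_boundary_eq_zero_iff φ
    have h2 : F' φ = 0 ↔ φ ∈ (LinearMap.range P.dual.coboundary ⊔ LinearMap.ker P.dual.boundary :
        Submodule ℤ P.dual.dartModule) := Jac.mk_boundary_eq_zero_iff (X := P.dual) φ
    rw [AddMonoidHom.mem_ker, AddMonoidHom.mem_ker, h1, h2, ← P.range_coboundary hX,
      ← P.range_coboundary_dual hX, sup_comm]
    rfl
  let θ : X.Jac ≃+ P.dual.Jac := (QuotientAddGroup.quotientKerEquivOfSurjective F hF).symm.trans
    ((QuotientAddGroup.quotientAddEquivOfEq hker).trans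
      (QuotientAddGroup.quotientKerEquivOfSurjective F' hF'))
  refine ⟨θ, fun φ => ?_⟩
  have h : (QuotientAddGroup.quotientKerEquivOfSurjective F hF).symm (F ⟨φ.1, φ.2⟩) =
      QuotientAddGroup.mk ⟨φ.1, φ.2⟩ := by
    rw [AddEquiv.symm_apply_eq]
    rfl
  change θ (F ⟨φ.1, φ.2⟩) = _
  rw [AddEquiv.trans_apply, h]
  rfl

/-- The isomorphism of planar duality commutes with automorphisms that respect duals. -/
theorem jac_equiv_equivariant [Finite X.E] (hX : X.Connected) (θ : X.Jac ≃+ P.dual.Jac)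
    (hθ : ∀ φ : X.DartAssignment,
      θ (Jac.mk X (vertexConfig φ)) = Jac.mk P.dual (P.faceConfig φ))
    (f : X.Aut) (f' : P.dual.Aut) (hf : ∀ e, f'.onE (P.dualDart e) = P.dualDart (f.onE e))
    (y : X.Jac) : θ (X.jacRep f y) = P.dual.jacRep f' (θ y) := by
  have : Finite P.dual.E := inferInstanceAs (Finite X.E)
  obtain ⟨D, rfl⟩ := QuotientAddGroup.mk_surjective y
  obtain ⟨φ, rfl⟩ := hX.boundary_surjective D
  have hψ (e : X.E) : φ.1 (f.onE.symm e) + φ.1 (f.onE.symm (X.inv e)) = 0 := by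
    have h : f.onE.symm (X.inv e) = X.inv (f.onE.symm e) := by
      rw [Equiv.symm_apply_eq, f.map_inv, Equiv.apply_symm_apply]
    rw [h]
    exact φ.2 _
  let φ' : X.DartAssignment := ⟨φ.1, φ.2⟩
  -- The push-forward of φ; its vertex and face configurations are the translates of those of φ.
  let ψ : X.DartAssignment := ⟨fun e => φ.1 (f.onE.symm e), hψ⟩
  have h1 : f.onDiv0 (vertexConfig φ') = vertexConfig ψ :=
    f.onDiv0_vertexConfig φ' ψ fun e => congrArg φ.1 (f.onE.symm_apply_apply e)
  have h2 : f'.onDiv0 (P.faceConfig φ') = P.faceConfig ψ :=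
    f'.onDiv0_vertexConfig (X := P.dual) φ' ψ fun e => by
      have h : f'.onE e = f.onE e := hf e
      rw [h]
      exact congrArg φ.1 (f.onE.symm_apply_apply e)
  change θ (Jac.mk X (f.onDiv0 (vertexConfig φ'))) =
    f'.onJac (θ (Jac.mk X (vertexConfig φ')))
  rw [h1, hθ, hθ, Aut.onJac_mk, h2]

end PlanarEmbedding

end SerreGraph

/-! ### Finiteness of the layers -/

theorem powSubgroup_zero (𝒢 : Type w) [Group 𝒢] (p : ℕ) : powSubgroup 𝒢 p 0 = ⊤ :=
  top_unique fun g _ => Subgroup.subset_closure ⟨g, by simp⟩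

theorem powSubgroup_succ_le (𝒢 : Type w) [Group 𝒢] (p n : ℕ) :
    powSubgroup 𝒢 p (n + 1) ≤ powSubgroup 𝒢 p n := by
  refine (Subgroup.closure_le _).2 ?_
  rintro _ ⟨g, rfl⟩
  exact Subgroup.subset_closure ⟨g ^ p, by simp only [← pow_mul, pow_succ']⟩

/-- Uniformity makes each successive quotient finite, and indices multiply down the chain from the
whole group. -/
theorem IsUniformProP.index_powSubgroup_ne_zero {p d : ℕ} {𝒢 : Type w} [Group 𝒢]
    [TopologicalSpace 𝒢] (h : IsUniformProP p d 𝒢) (hp : p ≠ 0) (n : ℕ) :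
    (powSubgroup 𝒢 p n).index ≠ 0 := by
  induction n with
  | zero => simp [powSubgroup_zero]
  | succ n ih =>
    rw [← Subgroup.relIndex_mul_index (powSubgroup_succ_le 𝒢 p n)]
    refine mul_ne_zero ?_ ih
    obtain ⟨f⟩ := h.uniform n
    have : NeZero p := ⟨hp⟩
    have : Finite (powSubgroup 𝒢 p n ⧸ (powSubgroup 𝒢 p (n + 1)).subgroupOf (powSubgroup 𝒢 p n)) :=
      Finite.of_equiv _ f.symm.toEquiv
    exact Nat.card_pos.ne'

theorem IsUniformProP.finite_layerGroup {p d : ℕ} {𝒢 : Type w} [Group 𝒢]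
    [TopologicalSpace 𝒢] (h : IsUniformProP p d 𝒢) (hp : p ≠ 0) (n : ℕ) :
    Finite (layerGroup 𝒢 p n) :=
  have : (powSubgroup 𝒢 p n).FiniteIndex := ⟨h.index_powSubgroup_ne_zero hp n⟩
  Subgroup.finite_quotient_of_finiteIndex

/-- Let `(X_n)` be a branched `𝒢`-tower of connected planar graphs whose duals `(X_n^∨)` form a
`𝒢`-tower as well. Then, for all `n`, `∂φ ↦ ∂*φ` induces an isomorphism of `𝒢_n`-modules
`Jac(X_n) ≃ Jac(X_n^∨)`. -/
theorem theorem5p6 {p d : ℕ} (hp : p.Prime)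
    {𝒢 : Type w} [Group 𝒢] [TopologicalSpace 𝒢] (h𝒢 : IsUniformProP p d 𝒢)
    (X : SerreGraph.{u, v}) (hV : Finite X.V) (hE : Finite X.E) (hX : X.Connected)
    (T : TowerData 𝒢 X) (hT : ∀ n, (T.layer p n).Connected)
    (P : ∀ n, SerreGraph.PlanarEmbedding.{max u w, max v w, x} (T.layer p n))
    (D : DualTower T P) (n : ℕ) :
    (∀ u : (T.layer p n).Div0, ∃ φ : (T.layer p n).DartAssignment,
      SerreGraph.vertexConfig φ = u) ∧
    ∃ θ : (T.layer p n).Jac ≃+ (P n).dual.Jac,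
      (∀ φ : (T.layer p n).DartAssignment,
        θ (SerreGraph.Jac.mk _ (SerreGraph.vertexConfig φ)) =
          SerreGraph.Jac.mk _ ((P n).faceConfig φ)) ∧
      ∀ (g : layerGroup 𝒢 p n) (y : (T.layer p n).Jac),
        θ ((T.layer p n).jacRep (T.galois p n g) y) = (P n).dual.jacRep (D.galois n g) (θ y) := by
  have := h𝒢.finite_layerGroup hp.ne_zero n
  have : Finite (T.layer p n).V := inferInstanceAs (Finite (Σ _ : X.V, _ ⧸ _))
  have : Finite (T.layer p n).E := inferInstanceAs (Finite (X.E × layerGroup 𝒢 p n))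
  refine ⟨fun u => ?_, ?_⟩
  · obtain ⟨φ, hφ⟩ := (hT n).boundary_surjective u
    exact ⟨⟨φ.1, φ.2⟩, hφ⟩
  · obtain ⟨θ, hθ⟩ := (P n).exists_jac_equiv (hT n)
    exact ⟨θ, hθ, fun g y => (P n).jac_equiv_equivariant (hT n) θ hθ _ _
      (D.galois_dualDart n g) y⟩
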